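/- Let $(\Omega,\mathcal F)$ be a measurable space. For $k\ge 1$ let $C_{l,Lip}(\mathbb R^k)$ be the set of functions $\varphi:\mathbb R^k\to\mathbb R$ for which there are $C>0$ and $m\in\mathbb N$ with $|\varphi(x)-\varphi(y)|\le C(1+|x|^m+|y|^m)|x-y|$ for all $x,y$. Let $\mathcal H$ be a set of real random variables on $(\Omega,\mathcal F)$ that contains the constants and is such that $X_1,\dots,X_k\in\mathcal H$ and $\varphi\in C_{l,Lip}(\mathbb R^k)$ imply $\varphi(X_1,\dots,X_k)\in\mathcal H$. Let $\mathbb E:\mathcal H\to[-\infty,\infty]$ be a sub-linear expectation: for all $X,Y\in\mathcal H$, (a) $X\ge Y$ implies $\mathbb E[X]\ge\mathbb E[Y]$; (b) $\mathbb E[c]=c$ for $c\in\mathbb R$; (c) $\mathbb E[\lambda X]=\lambda\mathbb E[X]$ for $\lambda\ge 0$; (d) $\mathbb E[X+Y]\le\mathbb E[X]+\mathbb E[Y]$ whenever the right-hand side is not of the form $\infty-\infty$ or $-\infty+\infty$. Assume that $\mathbb E$ is regular, i.e. $\mathbb E[X_n]\to0$ whenever $X_n\in\mathcal H$ and $X_n(\omega)\downarrow0$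 for every $\omega\in\Omega$, and countably sub-additive, i.e. $\mathbb E[X]\le\sum_{n\ge1}\mathbb E[X_n]$ whenever $0\le X\le\sum_{n\ge1}X_n$ with $X,X_n\in\mathcal H$ and $X_n\ge0$. Let $\mathcal P$ be any set of probability measures on $(\Omega,\mathcal F)$ that represents $\mathbb E$, i.e. $\mathbb E[X]=\sup_{P\in\mathcal P}\mathbf E_P[X]$ for all $X\in\mathcal H$, and let $\mathbb V(A)=\sup_{P\in\mathcal P}P(A)$ for $A\in\mathcal F$. For a random variable $Y$ let $$C_{\mathbb V}(Y)=\int_0^\infty\mathbb V(Y>x)\,dx+\int_{-\infty}^0(\mathbb V(Y>x)-1)\,dx .$$ Call $X,Y\in\mathcal H$ identically distributed if $\mathbb E[\psi(X)]=\mathbb E[\psi(Y)]$ for all $\psi\in C_{l,Lip}(\mathbb R)$ for which both sides are finite. Call a sequence $(X_n)_{n\ge1}$ in $\mathcal H$ independent if, for every $n\ge1$ and every $\psi\in C_{l,Lip}(\mathbb R^{n+1})$, $$\mathbb E[\psi(X_1,\dots,X_n,X_{n+1})]=\mathbb E\big[\mathbb E[\psi(x,X_{n+1})]\big|_{x=(X_1,\dots,X_n)}\big].$$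 **Theorem.** Let $\alpha>1$, let $X\in\mathcal H$, and let $X_1,X_2,\dots\in\mathcal H$ be a sequence of independent random variables, each identically distributed with $X$; put $S_n=\sum_{k=1}^nX_k$. Suppose that $\mathbb E[X]=\mathbb E[-X]=0$ and $$C_{\mathbb V}\big(\exp\{(\log^+|X|)^\alpha\}\big)<\infty,\qquad \log^+ t=\max(\log t,0)\ (t>0),\quad \log^+0=0 .$$ Then $$\sum_{n=1}^\infty\exp\{(\log n)^\alpha\}\,\frac{(\log n)^{\alpha-1}}{n^2}\,\mathbb V\big(|S_n|>n\varepsilon\big)<\infty\qquad\text{for all }\varepsilon>1 .$$ -/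

import Mathlib

open MeasureTheory Filter Topology
open scoped ENNReal

noncomputable section

namespace SubLin

/-- The class `C_{l,Lip}` of locally Lipschitz functions of polynomial growth. It is used on
`Fin n → ℝ`, on `ℝ`, and on `(Fin m → ℝ) × (Fin n → ℝ)` (that is, `ℝ^(m+n)`); as all norms on these
spaces are equivalent, the class does not depend on the norm (the sup norm here). -/
def LocLip {F : Type*} [SeminormedAddCommGroup F] (φ : F → ℝ) : Prop :=
  ∃ C : ℝ, 0 < C ∧ ∃ m : ℕ, ∀ x y : F,
    |φ x - φ y| ≤ C * (1 + ‖x‖ ^ m + ‖y‖ ^ m) * ‖x - y‖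

/-- A sub-linear expectation space over the measurable space `Ω`: a set `H` of random variables,
stable under `C_{l,Lip}` functions of finitely many of its elements, and an extended-real valued
sub-linear expectation `E` on `H`. The values of `E` outside `H` are irrelevant. -/
structure SubLinearExpectation (Ω : Type*) [MeasurableSpace Ω] where
  H : Set (Ω → ℝ)
  measurable_of_mem : ∀ X ∈ H, Measurable X
  comp_mem : ∀ (n : ℕ) (X : Fin n → Ω → ℝ) (φ : (Fin n → ℝ) → ℝ),
    (∀ i, X i ∈ H) → LocLip φ → (fun ω => φ (fun i => X i ω)) ∈ H
  E : (Ω → ℝ) → EReal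
  mono : ∀ X ∈ H, ∀ Y ∈ H, (∀ ω, Y ω ≤ X ω) → E Y ≤ E X
  const : ∀ c : ℝ, E (fun _ => c) = (c : EReal)
  pos_homog : ∀ X ∈ H, ∀ c : ℝ, 0 ≤ c → E (fun ω => c * X ω) = (c : EReal) * E X
  sub_add : ∀ X ∈ H, ∀ Y ∈ H, ¬ (E X = ⊤ ∧ E Y = ⊥) → ¬ (E X = ⊥ ∧ E Y = ⊤) →
    E (fun ω => X ω + Y ω) ≤ E X + E Y

variable {Ω : Type*} [MeasurableSpace Ω]

namespace SubLinearExpectation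

/-- Regularity: `E (X n) → 0` whenever `X n ∈ H` decreases to `0` pointwise. For a sub-linear
expectation this forces `E` to be finite on `H` (apply it to `|X| / n`). -/
def Regular (𝓔 : SubLinearExpectation Ω) : Prop :=
  ∀ X : ℕ → Ω → ℝ, (∀ n, X n ∈ 𝓔.H) →
    (∀ ω, Antitone (fun n => X n ω)) → (∀ ω, Tendsto (fun n => X n ω) atTop (𝓝 0)) →
    Tendsto (fun n => 𝓔.E (X n)) atTop (𝓝 0)

/-- Countable sub-additivity for non-negative elements of `H`; the series are taken in `[0, ∞]`. -/
def CountablySubadditive (𝓔 : SubLinearExpectation Ω) : Prop :=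
  ∀ (X : Ω → ℝ) (Y : ℕ → Ω → ℝ), X ∈ 𝓔.H → (∀ n, Y n ∈ 𝓔.H) →
    (∀ ω, 0 ≤ X ω) → (∀ n ω, 0 ≤ Y n ω) →
    (∀ ω, ENNReal.ofReal (X ω) ≤ ∑' n, ENNReal.ofReal (Y n ω)) →
    (𝓔.E X).toENNReal ≤ ∑' n, (𝓔.E (Y n)).toENNReal

/-- The random vector `Y` is independent of the random vector `X`:
`E[ψ(X, Y)] = E[ E[ψ(x, Y)] |_{x = X} ]` for all `ψ` in `C_{l,Lip}`. The inner expectation is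
finite as soon as `E` is regular, so that `toReal` only changes its type. -/
def IndepOf (𝓔 : SubLinearExpectation Ω) {m n : ℕ} (X : Fin m → Ω → ℝ) (Y : Fin n → Ω → ℝ) :
    Prop :=
  ∀ ψ : (Fin m → ℝ) × (Fin n → ℝ) → ℝ, LocLip ψ →
    𝓔.E (fun ω => ψ (fun i => X i ω, fun j => Y j ω)) =
      𝓔.E (fun ω => (𝓔.E (fun ω' => ψ (fun i => X i ω, fun j => Y j ω'))).toReal)

/-- A sequence is independent if each term is independent of the vector of all the previous ones.
The sequence is indexed from `0`. -/
def IndepSeq (𝓔 : SubLinearExpectation Ω) (X : ℕ → Ω → ℝ) : Prop :=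
  ∀ n : ℕ, 𝓔.IndepOf (fun i : Fin (n + 1) => X i) (fun _ : Fin 1 => X (n + 1))

/-- `X` and `Y` are identically distributed: `E[ψ(X)] = E[ψ(Y)]` for all `ψ` in `C_{l,Lip}` for
which both are finite. -/
def SameDistrib (𝓔 : SubLinearExpectation Ω) (X Y : Ω → ℝ) : Prop :=
  ∀ ψ : ℝ → ℝ, LocLip ψ →
    𝓔.E (fun ω => ψ (X ω)) ≠ ⊤ → 𝓔.E (fun ω => ψ (X ω)) ≠ ⊥ →
    𝓔.E (fun ω => ψ (Y ω)) ≠ ⊤ → 𝓔.E (fun ω => ψ (Y ω)) ≠ ⊥ →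
    𝓔.E (fun ω => ψ (X ω)) = 𝓔.E (fun ω => ψ (Y ω))

end SubLinearExpectation

/-- The linear expectation of `X` under `P`, with values in `[-∞, ∞]`. -/
def linExp (P : ProbabilityMeasure Ω) (X : Ω → ℝ) : EReal :=
  ((∫⁻ ω, ENNReal.ofReal (X ω) ∂(P : Measure Ω) : ℝ≥0∞) : EReal) -
    ((∫⁻ ω, ENNReal.ofReal (-X ω) ∂(P : Measure Ω) : ℝ≥0∞) : EReal)

/-- The upper expectation `sup_{P ∈ PP} E_P[X]`. -/
def upperExp (PP : Set (ProbabilityMeasure Ω)) (X : Ω → ℝ) : EReal :=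
  ⨆ P ∈ PP, linExp P X

/-- The family `PP` represents `E`: `E[X] = sup_{P ∈ PP} E_P[X]` for all `X ∈ H`. -/
def Represents (PP : Set (ProbabilityMeasure Ω)) (𝓔 : SubLinearExpectation Ω) : Prop :=
  ∀ X ∈ 𝓔.H, 𝓔.E X = upperExp PP X

/-- The capacity `𝕍(A) = sup_{P ∈ PP} E_P[1_A] = sup_{P ∈ PP} P(A)`. -/
def capacity (PP : Set (ProbabilityMeasure Ω)) (A : Set Ω) : ℝ≥0∞ :=
  ⨆ P ∈ PP, (P : Measure Ω) A

/-- The Choquet integral `∫_0^∞ V(Y > x) dx + ∫_{-∞}^0 (V(Y > x) - 1) dx` of `Y`, for a set function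
`V` with values in `[0, 1]`. -/
def choquet (V : Set Ω → ℝ≥0∞) (Y : Ω → ℝ) : EReal :=
  ((∫⁻ x in Set.Ioi (0 : ℝ), V {ω | x < Y ω} : ℝ≥0∞) : EReal) -
    ((∫⁻ x in Set.Iio (0 : ℝ), (1 - V {ω | x < Y ω}) : ℝ≥0∞) : EReal)

end SubLin

end

/-! A large sum arises from one large summand or from many moderate ones. With `1 < a < ε`, truncate
each summand from above at `b = a n`. If some summand exceeds `b`, the cost is at most `n 𝕍(X > n +
1)`. The weight times `n` is at most twice the increment of `exp ((log x)^α)` from `n` to `n + 1`,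
so these costs sum to a layer-cake bound by the Choquet integral (`weight_mul_le_sub`,
`tsum_sub_mul_capacity_le`).

Otherwise apply the exponential Markov inequality with `t = (a/ε) (log b)^α / b`, for which `t n ε =
(log b)^α ≥ (log n)^α`. As `a/ε < 1`, the Choquet moment controls the quadratic remainder
(`exists_exp_mul_min_le`), and the linear term is nonpositive by centring. Independence then gives a
moment generating function at most `exp (O(n t²)) = O(1)`. The resulting bound `C exp (-(log n)^α)`
cancels the exponential weight and leaves the summable `(log n)^(α-1) / n²`. Applying this to `X`
and `-X` gives both tails. -/

namespace SubLin

/-! ### Elementary inequalities for `exp` and powers of `log`. -/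

section RealEstimates

/-- The factor `exp (max u 0)`, rather than `exp |u|`, suits variables truncated only from above: a
large negative `u` costs no more than `u ^ 2`. -/
lemma exp_le_one_add_add_sq_mul_exp (u : ℝ) :
    Real.exp u ≤ 1 + u + u ^ 2 * Real.exp (max u 0) := by
  rcases le_or_gt u 1 with h | h
  · have h1 : 1 ≤ Real.exp (max u 0) := Real.one_le_exp (le_max_right _ _)
    have h2 : u ^ 2 ≤ u ^ 2 * Real.exp (max u 0) := le_mul_of_one_le_right (sq_nonneg u) h1
    rcases le_or_gt (-1) u with h' | h'
    · have := (abs_le.1 (Real.abs_exp_sub_one_sub_id_le (abs_le.2 ⟨h', h⟩))).2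
      linarith
    · have : Real.exp u ≤ 1 := Real.exp_le_one_iff.2 (by linarith)
      nlinarith
  · rw [max_eq_left (by linarith)]
    have : Real.exp u ≤ u ^ 2 * Real.exp u :=
      le_mul_of_one_le_left (Real.exp_pos u).le (by nlinarith)
    linarith

/-- The function is the `α`-th power of `log x / x ^ (1/α)`, which decreases from `exp α` on. -/
lemma log_rpow_div_self_antitoneOn {α : ℝ} (hα : 0 < α) :
    AntitoneOn (fun x : ℝ => Real.log x ^ α / x) {x | Real.exp α ≤ x} := by
  intro x hx y hy hxy
  have hx' : Real.exp α ≤ x := hx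
  have hy' : Real.exp α ≤ y := hy
  have hx0 : 0 < x := (Real.exp_pos α).trans_le hx'
  have hy0 : 0 < y := (Real.exp_pos α).trans_le hy'
  have hx1 : 1 ≤ x := (Real.one_le_exp hα.le).trans hx'
  have hy1 : 1 ≤ y := (Real.one_le_exp hα.le).trans hy'
  have key := Real.log_div_self_rpow_antitoneOn (inv_pos.2 hα)
    (by simpa using hx') (by simpa using hy') hxy
  have h2 := Real.rpow_le_rpow
    (div_nonneg (Real.log_nonneg hy1) (Real.rpow_nonneg hy0.le _)) key hα.le
  have e : ∀ z : ℝ, 1 ≤ z → (Real.log z / z ^ α⁻¹) ^ α = Real.log z ^ α / z := fun z hz => by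
    have hz0 : 0 ≤ z := zero_le_one.trans hz
    rw [Real.div_rpow (Real.log_nonneg hz) (Real.rpow_nonneg hz0 _), ← Real.rpow_mul hz0,
      inv_mul_cancel₀ hα.ne', Real.rpow_one]
  simpa only [e x hx1, e y hy1] using h2

lemma log_rpow_le_mul_rpow {p q x : ℝ} (hp : 0 < p) (hq : 0 < q) (hx : 1 ≤ x) :
    Real.log x ^ p ≤ (p / q) ^ p * x ^ q := by
  have hx0 : 0 ≤ x := zero_le_one.trans hx
  have h := Real.rpow_le_rpow (Real.log_nonneg hx)
    (Real.log_le_rpow_div hx0 (div_pos hq hp)) hp.le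
  refine h.trans_eq ?_
  rw [Real.div_rpow (Real.rpow_nonneg hx0 _) (div_pos hq hp).le, ← Real.rpow_mul hx0,
    div_mul_cancel₀ _ hp.ne', div_eq_mul_inv, ← Real.inv_rpow (div_pos hq hp).le, inv_div, mul_comm]

/-- Superlinearity of `L ^ α`: with `L = log |x|`, it lets `exp (c L ^ α)` absorb any power of
`|x|`. The threshold `L₀` solves `c L ^ (α - 1) = A`. -/
lemma exists_mul_le_mul_rpow_add {α : ℝ} (hα : 1 < α) (A : ℝ) {c : ℝ} (hc : 0 < c) (hA : 0 ≤ A) :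
    ∃ K : ℝ, 0 ≤ K ∧ ∀ L : ℝ, 0 ≤ L → A * L ≤ c * L ^ α + K := by
  set L₀ := (A / c) ^ (1 / (α - 1)) with hL₀
  have hα' : 0 < α - 1 := by linarith
  have h0 : 0 ≤ A / c := by positivity
  have hL₀0 : 0 ≤ L₀ := Real.rpow_nonneg h0 _
  refine ⟨A * L₀, by positivity, fun L hL => ?_⟩
  rcases le_or_gt L L₀ with h | h
  · have : 0 ≤ c * L ^ α := by positivity
    nlinarith
  · have hLpos : 0 < L := hL₀0.trans_lt h
    have h1 : A / c ≤ L ^ (α - 1) := by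
      have := Real.rpow_le_rpow hL₀0 h.le hα'.le
      rwa [hL₀, ← Real.rpow_mul h0, one_div, inv_mul_cancel₀ hα'.ne', Real.rpow_one] at this
    have h2 : L ^ α = L ^ (α - 1) * L := by
      rw [← Real.rpow_add_one hLpos.ne']; ring_nf
    rw [div_le_iff₀ hc] at h1
    have h3 : A * L ≤ c * L ^ α := by rw [h2]; nlinarith
    nlinarith [mul_nonneg hA hL₀0]

lemma abs_le_exp_posLog (x : ℝ) : |x| ≤ Real.exp (Real.posLog |x|) := by
  rcases eq_or_ne x 0 with rfl | h
  · simp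
  · calc |x| = Real.exp (Real.log |x|) := (Real.exp_log (abs_pos.2 h)).symm
      _ ≤ _ := Real.exp_le_exp.2 (le_max_right _ _)

lemma exists_abs_le_mul_exp_posLog_rpow {α : ℝ} (hα : 1 < α) :
    ∃ K : ℝ, 0 ≤ K ∧ ∀ x : ℝ, |x| ≤ K * Real.exp (Real.posLog |x| ^ α) := by
  obtain ⟨K, -, hK⟩ := exists_mul_le_mul_rpow_add hα 1 one_pos zero_le_one
  refine ⟨Real.exp K, (Real.exp_pos K).le, fun x => (abs_le_exp_posLog x).trans ?_⟩
  rw [← Real.exp_add, Real.exp_le_exp]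
  linarith [hK _ (Real.posLog_nonneg (x := |x|))]

/-- For `t = l (log b)^α / b` with `l < 1`, the quadratic remainder of `exp (t min(x, b))` is
dominated by `t² exp ((log⁺ |x|)^α)`, uniformly in the truncation level `b`. -/
lemma exists_exp_mul_min_le {α : ℝ} (hα : 1 < α) {l : ℝ} (hl : 0 < l) (hl1 : l < 1) :
    ∃ K : ℝ, 0 ≤ K ∧ ∀ b : ℝ, Real.exp α ≤ b → ∀ t : ℝ, t = l * (Real.log b ^ α / b) → ∀ x : ℝ,
      Real.exp (t * min x b) ≤
        1 + t * min x b + t ^ 2 * (K * Real.exp (Real.posLog |x| ^ α)) := by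
  have hα0 : 0 < α := by linarith
  -- The slack `1 - l` in the exponent pays for the factor `(min x b) ^ 2 ≤ exp (2 * L)`.
  obtain ⟨K, -, hK⟩ := exists_mul_le_mul_rpow_add hα 2 (sub_pos.2 hl1) zero_le_two
  set D := l * α ^ α with hD
  refine ⟨Real.exp (K + D), (Real.exp_pos _).le, fun b hb t ht x => ?_⟩
  have hb0 : 0 < b := (Real.exp_pos α).trans_le hb
  have hb1 : 1 ≤ b := (Real.one_le_exp hα0.le).trans hb
  have ht0 : 0 ≤ t := by
    have := Real.log_nonneg hb1
    rw [ht]; positivity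
  refine (exp_le_one_add_add_sq_mul_exp (t * min x b)).trans ?_
  have hmono := log_rpow_div_self_antitoneOn hα0
  set L := Real.posLog |x| with hLdef
  have hL : 0 ≤ L := Real.posLog_nonneg
  have hD0 : 0 ≤ D := by positivity
  have hexp : max (t * min x b) 0 ≤ D + l * L ^ α := by
    have hr : 0 ≤ l * L ^ α := by positivity
    refine max_le ?_ (by linarith)
    -- Above `exp α`, with `y = min x b ≤ b`, monotonicity gives `t y ≤ l (log y) ^ α`. Below it,
    -- `D` is the value of this bound at `y = exp α`.
    rcases le_or_gt (min x b) (Real.exp α) with h | h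
    · have h1 : t * Real.exp α ≤ D := by
        have := hmono (Set.mem_ofPred.2 le_rfl) (Set.mem_ofPred.2 hb) hb
        simp only [Real.log_exp] at this
        rw [le_div_iff₀ (Real.exp_pos α)] at this
        rw [ht, hD]
        nlinarith
      nlinarith [mul_le_mul_of_nonneg_left h ht0]
    · have hy0 : 0 < min x b := (Real.exp_pos α).trans h
      have h1 := hmono (Set.mem_ofPred.2 h.le) (Set.mem_ofPred.2 hb) (min_le_right x b)
      simp only at h1
      rw [le_div_iff₀ hy0] at h1
      have h2 : Real.log (min x b) ≤ L :=
        (Real.log_le_log hy0 ((min_le_left _ _).trans (le_abs_self x))).trans (le_max_right _ _)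
      have h3 : Real.log (min x b) ^ α ≤ L ^ α :=
        Real.rpow_le_rpow (Real.log_nonneg ((Real.one_le_exp hα0.le).trans h.le)) h2 hα0.le
      have : t * min x b ≤ l * L ^ α := by
        rw [ht]; nlinarith
      linarith
  have hsq : (min x b) ^ 2 ≤ Real.exp (2 * L) := by
    have h1 : |min x b| ≤ |x| := by
      rcases le_total x b with h | h
      · rw [min_eq_left h]
      · rw [min_eq_right h, abs_of_pos hb0]; exact h.trans (le_abs_self x)
    have h2 := h1.trans (abs_le_exp_posLog x)
    rw [two_mul, Real.exp_add, ← sq, ← sq_abs]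
    exact pow_le_pow_left₀ (abs_nonneg _) h2 2
  have : (min x b) ^ 2 * Real.exp (max (t * min x b) 0) ≤
      Real.exp (K + D) * Real.exp (L ^ α) := by
    calc _ ≤ Real.exp (2 * L) * Real.exp (D + l * L ^ α) := by gcongr
      _ ≤ _ := by
        rw [← Real.exp_add, ← Real.exp_add, Real.exp_le_exp]
        linarith [hK L hL]
  have := mul_le_mul_of_nonneg_left this (sq_nonneg t)
  rw [mul_pow]
  linarith

/-- The weight of the series is controlled by the increments of `exp ((log x)^α)`. -/
lemma weight_mul_le_sub {α : ℝ} (hα : 1 < α) {x : ℝ} (hx : 1 ≤ x) :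
    Real.exp (Real.log x ^ α) * Real.log x ^ (α - 1) / x ^ 2 * x ≤
      2 * (Real.exp (Real.log (x + 1) ^ α) - Real.exp (Real.log x ^ α)) := by
  have hx0 : 0 < x := by linarith
  set u := Real.log x
  set v := Real.log (x + 1)
  have hu : 0 ≤ u := Real.log_nonneg hx
  have huv : u ≤ v := Real.log_le_log hx0 (by linarith)
  -- `log (1 + 1/x) ≥ 1 / (x + 1) ≥ 1 / (2 x)` since `x ≥ 1`; this is the source of the factor 2.
  have h1 : 1 / (2 * x) ≤ v - u := by
    have h := Real.one_sub_inv_le_log_of_pos (x := (x + 1) / x) (by positivity)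
    rw [Real.log_div (by positivity) hx0.ne', inv_div] at h
    refine le_trans ?_ h
    rw [one_sub_div (by positivity), add_sub_cancel_left]
    gcongr
    linarith
  have pw : ∀ z : ℝ, 0 ≤ z → z ^ α = z ^ (α - 1) * z := fun z hz => by
    rw [← Real.rpow_add_one' hz (by linarith)]; ring_nf
  have h2 : u ^ (α - 1) * (v - u) ≤ v ^ α - u ^ α := by
    have : u ^ (α - 1) ≤ v ^ (α - 1) := Real.rpow_le_rpow hu huv (by linarith)
    rw [pw u hu, pw v (hu.trans huv)]
    nlinarith [hu.trans huv]
  have h3 : Real.exp (u ^ α) * (v ^ α - u ^ α) ≤ Real.exp (v ^ α) - Real.exp (u ^ α) := by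
    have := Real.add_one_le_exp (v ^ α - u ^ α)
    have e : Real.exp (v ^ α) = Real.exp (u ^ α) * Real.exp (v ^ α - u ^ α) := by
      rw [← Real.exp_add]; ring_nf
    rw [e]
    nlinarith [Real.exp_pos (u ^ α)]
  have h4 : u ^ (α - 1) * (1 / (2 * x)) ≤ v ^ α - u ^ α :=
    (mul_le_mul_of_nonneg_left h1 (Real.rpow_nonneg hu _)).trans h2
  have h5 := (mul_le_mul_of_nonneg_left h4 (Real.exp_pos (u ^ α)).le).trans h3
  calc _ = 2 * (Real.exp (u ^ α) * (u ^ (α - 1) * (1 / (2 * x)))) := by field_simp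
    _ ≤ _ := by linarith

lemma abs_exp_sub_exp_le {u v B : ℝ} (hu : u ≤ B) (hv : v ≤ B) :
    |Real.exp u - Real.exp v| ≤ Real.exp B * |u - v| := by
  wlog h : v ≤ u generalizing u v
  · rw [abs_sub_comm, abs_sub_comm u]
    exact this hv hu (le_of_not_ge h)
  rw [abs_of_nonneg (sub_nonneg.2 (Real.exp_le_exp.2 h)), abs_of_nonneg (sub_nonneg.2 h)]
  have h1 := Real.add_one_le_exp (v - u)
  have e : Real.exp v = Real.exp u * Real.exp (v - u) := by rw [← Real.exp_add]; ring_nf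
  have h2 : Real.exp u - Real.exp v ≤ Real.exp u * (u - v) := by
    rw [e]; nlinarith [Real.exp_pos u]
  exact h2.trans (mul_le_mul_of_nonneg_right (Real.exp_le_exp.2 hu) (sub_nonneg.2 h))

end RealEstimates

/-! ### Admissible test functions. -/

section LocLip

variable {F : Type*} [SeminormedAddCommGroup F]

lemma LocLip.of_le {φ : F → ℝ} (K : ℝ) (h : ∀ x y, |φ x - φ y| ≤ K * ‖x - y‖) : LocLip φ := by
  refine ⟨max K 1, by positivity, 0, fun x y => (h x y).trans ?_⟩
  refine mul_le_mul_of_nonneg_right ?_ (norm_nonneg _)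
  have := le_max_left K 1
  have := le_max_right K 1
  simp only [pow_zero]
  linarith

/-- The exponential itself grows too fast to be admissible; an upper bound on the exponent makes it
Lipschitz. Truncation from above therefore suffices. -/
lemma LocLip.exp_of_le {h : F → ℝ} (K B : ℝ) (hB : ∀ x, h x ≤ B)
    (hK : ∀ x y, |h x - h y| ≤ K * ‖x - y‖) : LocLip (fun x => Real.exp (h x)) := by
  refine LocLip.of_le (Real.exp B * K) fun x y => ?_
  rw [mul_assoc]
  exact (abs_exp_sub_exp_le (hB x) (hB y)).trans
    (mul_le_mul_of_nonneg_left (hK x y) (Real.exp_pos B).le)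

lemma LocLip.comp_neg {φ : F → ℝ} (h : LocLip φ) : LocLip (fun x => φ (-x)) := by
  obtain ⟨C, hC, m, hm⟩ := h
  refine ⟨C, hC, m, fun x y => (hm (-x) (-y)).trans_eq ?_⟩
  rw [norm_neg, norm_neg, ← neg_sub', norm_neg]

lemma abs_min_sub_min_right_le (x y b : ℝ) : |min x b - min y b| ≤ |x - y| := by
  simpa using abs_min_sub_min_le_max x b y b

end LocLip
end SubLin

namespace SubLin

variable {Ω : Type*} [MeasurableSpace Ω]

lemma LocLip.comp_eval {ι : Type*} [Fintype ι] {φ : ℝ → ℝ} (h : LocLip φ) (i : ι) :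
    LocLip (fun x : ι → ℝ => φ (x i)) := by
  obtain ⟨C, hC, m, hm⟩ := h
  refine ⟨C, hC, m, fun x y => (hm (x i) (y i)).trans ?_⟩
  have h1 := norm_le_pi_norm x i
  have h2 := norm_le_pi_norm y i
  have h3 : ‖x i - y i‖ ≤ ‖x - y‖ := norm_le_pi_norm (x - y) i
  gcongr

/-! ### Linear expectations, capacities and Choquet integrals. -/

section LinExp

lemma linExp_of_nonneg (P : ProbabilityMeasure Ω) {X : Ω → ℝ} (h : ∀ ω, 0 ≤ X ω) :
    linExp P X = ((∫⁻ ω, ENNReal.ofReal (X ω) ∂(P : Measure Ω) : ℝ≥0∞) : EReal) := by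
  have : ∀ ω, ENNReal.ofReal (-X ω) = 0 := fun ω =>
    ENNReal.ofReal_of_nonpos (neg_nonpos.2 (h ω))
  simp [linExp, this]

lemma linExp_of_integrable (P : ProbabilityMeasure Ω) {X : Ω → ℝ}
    (h : Integrable X (P : Measure Ω)) :
    linExp P X = ((∫ ω, X ω ∂(P : Measure Ω) : ℝ) : EReal) := by
  have hneg : ∫⁻ ω, ENNReal.ofReal (-X ω) ∂(P : Measure Ω) ≠ ⊤ := h.neg.lintegral_lt_top.ne
  rw [integral_eq_lintegral_pos_part_sub_lintegral_neg_part h, linExp, EReal.coe_sub,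
    EReal.coe_ennreal_toReal h.lintegral_lt_top.ne,
    EReal.coe_ennreal_toReal hneg]

lemma linExp_le_of_represents {PP : Set (ProbabilityMeasure Ω)} {𝓔 : SubLinearExpectation Ω}
    (hPP : Represents PP 𝓔) {P : ProbabilityMeasure Ω} (hP : P ∈ PP) {X : Ω → ℝ} (hX : X ∈ 𝓔.H) :
    linExp P X ≤ 𝓔.E X := by
  rw [hPP X hX]
  exact le_iSup₂ (f := fun P (_ : P ∈ PP) => linExp P X) P hP

end LinExp

section Capacity

variable (PP : Set (ProbabilityMeasure Ω))

lemma measure_le_capacity {P : ProbabilityMeasure Ω} (hP : P ∈ PP) (A : Set Ω) :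
    (P : Measure Ω) A ≤ capacity PP A :=
  le_iSup₂ (f := fun (P : ProbabilityMeasure Ω) (_ : P ∈ PP) => (P : Measure Ω) A) P hP

lemma capacity_mono {A B : Set Ω} (h : A ⊆ B) : capacity PP A ≤ capacity PP B :=
  iSup₂_mono fun _ _ => measure_mono h

lemma capacity_le_one (A : Set Ω) : capacity PP A ≤ 1 :=
  iSup₂_le fun _ _ => prob_le_one

lemma capacity_union_le (A B : Set Ω) :
    capacity PP (A ∪ B) ≤ capacity PP A + capacity PP B :=
  iSup₂_le fun _ hP => (measure_union_le A B).trans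
    (add_le_add (measure_le_capacity PP hP A) (measure_le_capacity PP hP B))

lemma capacity_biUnion_finset_le {ι : Type*} (s : Finset ι) (A : ι → Set Ω) :
    capacity PP (⋃ i ∈ s, A i) ≤ ∑ i ∈ s, capacity PP (A i) :=
  iSup₂_le fun _ hP => (measure_biUnion_finset_le s A).trans
    (Finset.sum_le_sum fun i _ => measure_le_capacity PP hP (A i))

lemma lintegral_le_lintegral_capacity {P : ProbabilityMeasure Ω} (hP : P ∈ PP) {Y : Ω → ℝ}
    (hY : Measurable Y) (h0 : ∀ ω, 0 ≤ Y ω) :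
    ∫⁻ ω, ENNReal.ofReal (Y ω) ∂(P : Measure Ω) ≤
      ∫⁻ x in Set.Ioi (0 : ℝ), capacity PP {ω | x < Y ω} := by
  rw [lintegral_eq_lintegral_meas_lt _ (.of_forall h0) hY.aemeasurable]
  exact lintegral_mono fun x => measure_le_capacity PP hP _

lemma lintegral_capacity_lt_top {Y : Ω → ℝ} (h0 : ∀ ω, 0 ≤ Y ω)
    (h : choquet (capacity PP) Y < ⊤) :
    ∫⁻ x in Set.Ioi (0 : ℝ), capacity PP {ω | x < Y ω} < ⊤ := by
  -- With a nonempty family the capacity of the whole space is 1, which kills the negative half of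
  -- the Choquet integral; the empty family has zero capacity.
  rcases PP.eq_empty_or_nonempty with rfl | ⟨P, hP⟩
  · simp [capacity]
  have hneg : ∫⁻ x in Set.Iio (0 : ℝ), (1 - capacity PP {ω | x < Y ω}) = 0 := by
    refine (setLIntegral_congr_fun (g := fun _ => 0) measurableSet_Iio fun x hx => ?_).trans
      (by simp)
    have hu : {ω | x < Y ω} = Set.univ := Set.eq_univ_of_forall fun ω => lt_of_lt_of_le hx (h0 ω)
    have : 1 ≤ capacity PP {ω | x < Y ω} := by
      rw [hu]
      exact (measure_univ (μ := (P : Measure Ω))).symm.le.trans (measure_le_capacity PP hP _)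
    exact tsub_eq_zero_of_le this
  rw [choquet, hneg] at h
  rw [lt_top_iff_ne_top]
  intro htop
  simp [htop] at h

end Capacity

/-! ### Tail comparison and moment generating functions under `𝓔`. -/

namespace SubLinearExpectation

variable {𝓔 : SubLinearExpectation Ω}

lemma comp_mem_of_locLip {X : Ω → ℝ} (hX : X ∈ 𝓔.H) {φ : ℝ → ℝ} (hφ : LocLip φ) :
    (fun ω => φ (X ω)) ∈ 𝓔.H :=
  𝓔.comp_mem 1 (fun _ => X) (fun x => φ (x 0)) (fun _ => hX) (hφ.comp_eval 0)

lemma const_mem (c : ℝ) : (fun _ => c) ∈ 𝓔.H :=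
  𝓔.comp_mem 0 (fun i => i.elim0) (fun _ => c) (fun i => i.elim0)
    (LocLip.of_le 0 (by simp))

lemma neg_mem {X : Ω → ℝ} (hX : X ∈ 𝓔.H) : (fun ω => -X ω) ∈ 𝓔.H :=
  comp_mem_of_locLip hX (φ := fun x => -x) (LocLip.of_le 1 fun x y => by
    rw [one_mul, ← neg_sub', abs_neg, Real.norm_eq_abs])

lemma exists_real_of_bounded {X : Ω → ℝ} (hX : X ∈ 𝓔.H) {a b : ℝ} (ha : ∀ ω, a ≤ X ω)
    (hb : ∀ ω, X ω ≤ b) : ∃ r : ℝ, a ≤ r ∧ 𝓔.E X = r := by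
  have h1 : (a : EReal) ≤ 𝓔.E X := by
    rw [← 𝓔.const a]; exact 𝓔.mono _ hX _ (const_mem a) ha
  have h2 : 𝓔.E X ≤ (b : EReal) := by
    rw [← 𝓔.const b]; exact 𝓔.mono _ (const_mem b) _ hX hb
  have h3 : 𝓔.E X ≠ ⊤ := (h2.trans_lt (EReal.coe_lt_top b)).ne
  have h4 : 𝓔.E X ≠ ⊥ := ((EReal.bot_lt_coe a).trans_le h1).ne'
  refine ⟨(𝓔.E X).toReal, ?_, (EReal.coe_toReal h3 h4).symm⟩
  rwa [← EReal.coe_toReal h3 h4, EReal.coe_le_coe_iff] at h1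

lemma SameDistrib.eq_of_bounded {X Y : Ω → ℝ} (h : 𝓔.SameDistrib X Y) (hX : X ∈ 𝓔.H)
    (hY : Y ∈ 𝓔.H) {ψ : ℝ → ℝ} (hψ : LocLip ψ) {a b : ℝ} (ha : ∀ x, a ≤ ψ x)
    (hb : ∀ x, ψ x ≤ b) : 𝓔.E (fun ω => ψ (X ω)) = 𝓔.E (fun ω => ψ (Y ω)) := by
  obtain ⟨r, -, hr⟩ := exists_real_of_bounded (comp_mem_of_locLip hX hψ)
    (fun ω => ha (X ω)) (fun ω => hb (X ω))
  obtain ⟨s, -, hs⟩ := exists_real_of_bounded (comp_mem_of_locLip hY hψ)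
    (fun ω => ha (Y ω)) (fun ω => hb (Y ω))
  exact h ψ hψ (by simp [hr]) (by simp [hr]) (by simp [hs]) (by simp [hs])

lemma SameDistrib.neg {X Y : Ω → ℝ} (h : 𝓔.SameDistrib X Y) :
    𝓔.SameDistrib (fun ω => -X ω) (fun ω => -Y ω) :=
  fun _ hψ => h _ hψ.comp_neg

lemma IndepSeq.neg {Xs : ℕ → Ω → ℝ} (h : 𝓔.IndepSeq Xs) :
    𝓔.IndepSeq (fun k ω => -Xs k ω) :=
  fun n _ hψ => h n _ hψ.comp_neg

/-- Indicators are not admissible test functions, so a ramp rising from 0 at `c` to 1 at `d` is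
inserted between them; hence the gap `c < d`. -/
lemma capacity_lt_le_of_sameDistrib {PP : Set (ProbabilityMeasure Ω)} (hPP : Represents PP 𝓔)
    {X Y : Ω → ℝ} (h : 𝓔.SameDistrib X Y) (hX : X ∈ 𝓔.H) (hY : Y ∈ 𝓔.H) {c d : ℝ} (hcd : c < d) :
    capacity PP {ω | d < X ω} ≤ capacity PP {ω | c < Y ω} := by
  have hdc : 0 < d - c := sub_pos.2 hcd
  set ψ : ℝ → ℝ := fun x => max 0 (min 1 ((x - c) / (d - c))) with hψdef
  have hψ0 : ∀ x, 0 ≤ ψ x := fun x => le_max_left _ _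
  have hψ1 : ∀ x, ψ x ≤ 1 := fun x => max_le zero_le_one (min_le_left _ _)
  have hψ : LocLip ψ := by
    refine LocLip.of_le (d - c)⁻¹ fun x y => ?_
    have h1 := abs_max_sub_max_le_max 0 (min 1 ((x - c) / (d - c))) 0 (min 1 ((y - c) / (d - c)))
    have h2 := abs_min_sub_min_le_max 1 ((x - c) / (d - c)) 1 ((y - c) / (d - c))
    simp only [sub_self, abs_zero, abs_nonneg, sup_of_le_right] at h1 h2
    refine h1.trans (h2.trans_eq ?_)
    rw [← sub_div, sub_sub_sub_cancel_right, abs_div, abs_of_pos hdc, Real.norm_eq_abs,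
      div_eq_inv_mul]
  have hE := h.eq_of_bounded hX hY hψ hψ0 hψ1
  refine iSup₂_le fun P hP => ?_
  rw [← EReal.coe_ennreal_le_coe_ennreal_iff]
  calc (((P : Measure Ω) {ω | d < X ω} : ℝ≥0∞) : EReal)
      ≤ linExp P (fun ω => ψ (X ω)) := by
        rw [linExp_of_nonneg P fun ω => hψ0 (X ω), EReal.coe_ennreal_le_coe_ennreal_iff,
          ← lintegral_indicator_one (measurableSet_lt measurable_const
            (𝓔.measurable_of_mem X hX))]
        refine lintegral_mono (Set.indicator_le fun ω hω => ?_)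
        have hω : d < X ω := hω
        have : 1 ≤ (X ω - c) / (d - c) := by rw [one_le_div hdc]; linarith
        simp [hψdef, min_eq_left this]
    _ ≤ 𝓔.E (fun ω => ψ (X ω)) := linExp_le_of_represents hPP hP (comp_mem_of_locLip hX hψ)
    _ = upperExp PP (fun ω => ψ (Y ω)) := by rw [hE, hPP _ (comp_mem_of_locLip hY hψ)]
    _ ≤ (capacity PP {ω | c < Y ω} : EReal) := by
        refine iSup₂_le fun Q hQ => ?_
        rw [linExp_of_nonneg Q fun ω => hψ0 (Y ω), EReal.coe_ennreal_le_coe_ennreal_iff]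
        refine le_trans ?_ (measure_le_capacity PP hQ _)
        rw [← lintegral_indicator_one (measurableSet_lt measurable_const
            (𝓔.measurable_of_mem Y hY))]
        refine lintegral_mono fun ω => ?_
        by_cases hω : c < Y ω
        · rw [Set.indicator_of_mem (by exact hω)]
          simpa using hψ1 (Y ω)
        · have : (Y ω - c) / (d - c) ≤ 0 :=
            div_nonpos_of_nonpos_of_nonneg (by linarith) hdc.le
          simp [hψdef, hω, min_eq_right (this.trans zero_le_one), this]

lemma capacity_lt_le_exp_mul {PP : Set (ProbabilityMeasure Ω)} (hPP : Represents PP 𝓔)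
    {S : Ω → ℝ} {t r : ℝ} (ht : 0 ≤ t) (hS : (fun ω => Real.exp (t * S ω)) ∈ 𝓔.H)
    (hr : 𝓔.E (fun ω => Real.exp (t * S ω)) ≤ r) (x : ℝ) :
    capacity PP {ω | x < S ω} ≤ ENNReal.ofReal (Real.exp (-(t * x)) * r) := by
  refine iSup₂_le fun P hP => ?_
  have h1 := (linExp_le_of_represents hPP hP hS).trans hr
  rw [linExp_of_nonneg P fun ω => (Real.exp_pos _).le] at h1
  have h2 : ∫⁻ ω, ENNReal.ofReal (Real.exp (t * S ω)) ∂(P : Measure Ω) ≤ ENNReal.ofReal r := by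
    rw [← EReal.coe_ennreal_le_coe_ennreal_iff]
    refine h1.trans ?_
    rw [EReal.coe_ennreal_ofReal, EReal.coe_le_coe_iff]
    exact le_max_left _ _
  have h3 := mul_meas_ge_le_lintegral (μ := (P : Measure Ω))
    (𝓔.measurable_of_mem _ hS).ennreal_ofReal (ENNReal.ofReal (Real.exp (t * x)))
  have h4 : (P : Measure Ω) {ω | x < S ω} ≤ (P : Measure Ω)
      {ω | ENNReal.ofReal (Real.exp (t * x)) ≤ ENNReal.ofReal (Real.exp (t * S ω))} := by
    refine measure_mono fun ω hω => ?_
    have hω : x < S ω := hω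
    exact ENNReal.ofReal_le_ofReal (Real.exp_le_exp.2 (mul_le_mul_of_nonneg_left hω.le ht))
  have h5 : ENNReal.ofReal (Real.exp (t * x)) * (P : Measure Ω) {ω | x < S ω} ≤
      ENNReal.ofReal r := (mul_le_mul_right h4 _).trans (h3.trans h2)
  rw [ENNReal.ofReal_mul (Real.exp_pos _).le, Real.exp_neg,
    ENNReal.ofReal_inv_of_pos (Real.exp_pos _)]
  rwa [← ENNReal.div_eq_inv_mul, ENNReal.le_div_iff_mul_le (by simp [Real.exp_pos]) (by simp),
    mul_comm]

/-- The moment generating function of a truncation of a centred variable. -/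
lemma E_exp_mul_min_le {PP : Set (ProbabilityMeasure Ω)} (hPP : Represents PP 𝓔)
    {X : Ω → ℝ} (hX : X ∈ 𝓔.H) (hmean : 𝓔.E X ≤ 0) {f : ℝ → ℝ} (hf : Measurable f)
    (hf0 : ∀ x, 0 ≤ f x) {K' : ℝ} (hK' : ∀ x, |x| ≤ K' * f x) {M : ℝ} (hM : 0 ≤ M)
    (hfM : ∀ P ∈ PP, ∫⁻ ω, ENNReal.ofReal (f (X ω)) ∂(P : Measure Ω) ≤ ENNReal.ofReal M)
    {t b K : ℝ} (ht : 0 ≤ t) (hK : 0 ≤ K)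
    (hmem : (fun ω => Real.exp (t * min (X ω) b)) ∈ 𝓔.H)
    (hle : ∀ x, Real.exp (t * min x b) ≤ 1 + t * min x b + t ^ 2 * (K * f x)) :
    𝓔.E (fun ω => Real.exp (t * min (X ω) b)) ≤ ((1 + t ^ 2 * (K * M) : ℝ) : EReal) := by
  rw [hPP _ hmem]
  refine iSup₂_le fun P hP => ?_
  have hXm := 𝓔.measurable_of_mem X hX
  have hfi : Integrable (fun ω => f (X ω)) (P : Measure Ω) := by
    refine ⟨(hf.comp hXm).aestronglyMeasurable, ?_⟩
    rw [hasFiniteIntegral_iff_ofReal (.of_forall fun ω => hf0 _)]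
    exact (hfM P hP).trans_lt ENNReal.ofReal_lt_top
  have hXi : Integrable X (P : Measure Ω) :=
    (hfi.const_mul K').mono' hXm.aestronglyMeasurable (.of_forall fun ω => hK' (X ω))
  have hYi : Integrable (fun ω => min (X ω) b) (P : Measure Ω) := hXi.inf (integrable_const b)
  have hgi : Integrable (fun ω => 1 + t * min (X ω) b + t ^ 2 * (K * f (X ω)))
      (P : Measure Ω) :=
    ((integrable_const 1).add (hYi.const_mul t)).add ((hfi.const_mul K).const_mul _)
  have hei : Integrable (fun ω => Real.exp (t * min (X ω) b)) (P : Measure Ω) :=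
    hgi.mono' (𝓔.measurable_of_mem _ hmem).aestronglyMeasurable
      (.of_forall fun ω => by rw [Real.norm_eq_abs, Real.abs_exp]; exact hle _)
  rw [linExp_of_integrable P hei, EReal.coe_le_coe_iff]
  -- Upper truncation only lowers the mean, so centring survives under every `P` without an error
  -- term.
  have h1 : ∫ ω, min (X ω) b ∂(P : Measure Ω) ≤ 0 := by
    refine (integral_mono hYi hXi fun ω => min_le_left _ _).trans ?_
    have := (linExp_le_of_represents hPP hP hX).trans hmean
    rw [linExp_of_integrable P hXi] at this
    exact_mod_cast this
  have h2 : ∫ ω, f (X ω) ∂(P : Measure Ω) ≤ M := by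
    rw [integral_eq_lintegral_of_nonneg_ae (.of_forall fun ω => hf0 _) hfi.1]
    exact ENNReal.toReal_le_of_le_ofReal hM (hfM P hP)
  refine (integral_mono hei hgi fun ω => hle _).trans ?_
  have hsum : Integrable (fun ω => 1 + t * min (X ω) b) (P : Measure Ω) :=
    (integrable_const 1).add (hYi.const_mul t)
  rw [integral_add hsum ((hfi.const_mul K).const_mul _), integral_add (integrable_const 1) (hYi.const_mul t),
    integral_const_mul, integral_const_mul, integral_const_mul]
  have h3 := mul_le_mul_of_nonneg_left h2 hK
  have h4 := mul_le_mul_of_nonneg_left h3 (sq_nonneg t)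
  have h5 := mul_nonpos_of_nonneg_of_nonpos ht h1
  simp only [integral_const, probReal_univ, smul_eq_mul, mul_one]
  linarith

lemma locLip_exp_sum_min {ι : Type*} [Fintype ι] {t b : ℝ} (ht : 0 ≤ t) :
    LocLip (fun x : ι → ℝ => Real.exp (t * ∑ i, min (x i) b)) := by
  refine LocLip.exp_of_le (t * Fintype.card ι) (t * (Fintype.card ι * b)) (fun x => ?_)
    fun x y => ?_
  · refine mul_le_mul_of_nonneg_left ?_ ht
    refine (Finset.sum_le_sum fun i _ => min_le_right _ _).trans_eq ?_
    simp
  · rw [← mul_sub, ← Finset.sum_sub_distrib, abs_mul, abs_of_nonneg ht, mul_assoc]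
    refine mul_le_mul_of_nonneg_left ((Finset.abs_sum_le_sum_abs _ _).trans ?_) ht
    refine (Finset.sum_le_sum fun i _ => (abs_min_sub_min_right_le _ _ _).trans
      (norm_le_pi_norm (x - y) i)).trans_eq ?_
    simp

lemma locLip_exp_min {t b : ℝ} (ht : 0 ≤ t) : LocLip (fun x : ℝ => Real.exp (t * min x b)) :=
  LocLip.exp_of_le t (t * b) (fun _ => mul_le_mul_of_nonneg_left (min_le_right _ _) ht)
    fun x y => by
      rw [← mul_sub, abs_mul, abs_of_nonneg ht]
      exact mul_le_mul_of_nonneg_left (abs_min_sub_min_right_le _ _ _) ht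

lemma locLip_exp_sum_min_add {ι κ : Type*} [Fintype ι] [Fintype κ] (j : κ) {t b : ℝ}
    (ht : 0 ≤ t) :
    LocLip (fun p : (ι → ℝ) × (κ → ℝ) =>
      Real.exp (t * (∑ i, min (p.1 i) b + min (p.2 j) b))) := by
  refine LocLip.exp_of_le (t * (Fintype.card ι + 1)) (t * (Fintype.card ι * b + b)) (fun p => ?_)
    fun p q => ?_
  · refine mul_le_mul_of_nonneg_left (add_le_add ?_ (min_le_right _ _)) ht
    refine (Finset.sum_le_sum fun i _ => min_le_right _ _).trans_eq ?_
    simp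
  · rw [← mul_sub, add_sub_add_comm, ← Finset.sum_sub_distrib, abs_mul, abs_of_nonneg ht,
      mul_assoc, add_mul, one_mul]
    refine mul_le_mul_of_nonneg_left ((abs_add_le _ _).trans (add_le_add ?_ ?_)) ht
    · refine (Finset.abs_sum_le_sum_abs _ _).trans ?_
      refine (Finset.sum_le_sum fun i _ => (abs_min_sub_min_right_le _ _ _).trans
        ((norm_le_pi_norm (p.1 - q.1) i).trans (norm_fst_le (p - q)))).trans_eq ?_
      simp
    · exact (abs_min_sub_min_right_le _ _ _).trans
        ((norm_le_pi_norm (p.2 - q.2) j).trans (norm_snd_le (p - q)))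

lemma exp_sum_min_mem {Xs : ℕ → Ω → ℝ} (hXs : ∀ k, Xs k ∈ 𝓔.H) {t b : ℝ} (ht : 0 ≤ t) (n : ℕ) :
    (fun ω => Real.exp (t * ∑ k ∈ Finset.range n, min (Xs k ω) b)) ∈ 𝓔.H := by
  simp only [Finset.sum_range]
  exact 𝓔.comp_mem n (fun i => Xs i) _ (fun i => hXs i) (locLip_exp_sum_min ht)

/-- Conditionally on the past, the exponential of the past sum is a nonnegative constant and leaves
the inner expectation by positive homogeneity. Hence an exact product. -/
lemma IndepSeq.E_exp_sum_min {Xs : ℕ → Ω → ℝ} (h : 𝓔.IndepSeq Xs) (hXs : ∀ k, Xs k ∈ 𝓔.H)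
    {t b q : ℝ} (ht : 0 ≤ t) (hq : 0 ≤ q)
    (hE : ∀ k, 𝓔.E (fun ω => Real.exp (t * min (Xs k ω) b)) = q) (n : ℕ) :
    𝓔.E (fun ω => Real.exp (t * ∑ k ∈ Finset.range n, min (Xs k ω) b)) = ((q ^ n : ℝ) : EReal) := by
  induction n with
  | zero => simpa using 𝓔.const 1
  | succ n ih =>
    -- `IndepSeq` speaks only of a nonempty past, so the one-term sum is separate.
    rcases n with _ | n
    · simpa using hE 0
    have hmem := exp_sum_min_mem hXs (b := b) ht (n + 1)
    have hind := h n _ (locLip_exp_sum_min_add (ι := Fin (n + 1)) (κ := Fin 1) (b := b) 0 ht)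
    have hinner : ∀ ω, 𝓔.E (fun ω' => Real.exp (t * (∑ i : Fin (n + 1), min (Xs i ω) b +
        min (Xs (n + 1) ω') b))) =
        ((q * Real.exp (t * ∑ k ∈ Finset.range (n + 1), min (Xs k ω) b) : ℝ) : EReal) := by
      intro ω
      simp only [mul_add, Real.exp_add]
      rw [𝓔.pos_homog _ (comp_mem_of_locLip (hXs (n + 1)) (locLip_exp_min ht)) _
        (Real.exp_pos _).le, hE, ← EReal.coe_mul, mul_comm, Finset.sum_range]
    simp only [hinner, EReal.toReal_coe] at hind
    rw [𝓔.pos_homog _ hmem q hq, ih, ← EReal.coe_mul, ← pow_succ'] at hind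
    rw [← hind]
    congr 1
    ext ω
    rw [Finset.sum_range_succ, Finset.sum_range]

end SubLinearExpectation
end SubLin

/-! ### The one-sided deviation bound. -/

namespace SubLin

variable {Ω : Type*} [MeasurableSpace Ω]

/-- One-sided deviation bound for sums of independent, identically distributed variables: truncate
each summand just below level `n ε` and apply the exponential Markov inequality to the rest. -/
lemma exists_capacity_sum_gt_le (𝓔 : SubLinearExpectation Ω)
    {PP : Set (ProbabilityMeasure Ω)} (hPP : Represents PP 𝓔) {α : ℝ} (hα : 1 < α)
    {X : Ω → ℝ} {Xs : ℕ → Ω → ℝ} (hX : X ∈ 𝓔.H) (hXs : ∀ k, Xs k ∈ 𝓔.H)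
    (hindep : 𝓔.IndepSeq Xs) (hident : ∀ k, 𝓔.SameDistrib (Xs k) X) (hmean : 𝓔.E X ≤ 0)
    (hint : ∫⁻ x in Set.Ioi (0 : ℝ),
      capacity PP {ω | x < Real.exp (Real.posLog |X ω| ^ α)} < ⊤)
    {ε : ℝ} (hε : 1 < ε) :
    ∃ C : ℝ, 0 ≤ C ∧ ∀ᶠ n : ℕ in atTop,
      capacity PP {ω | (n : ℝ) * ε < ∑ k ∈ Finset.range n, Xs k ω} ≤
        n * capacity PP {ω | (n : ℝ) + 1 < X ω} +
          ENNReal.ofReal (C * Real.exp (-(Real.log n ^ α))) := by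
  -- `a > 1` makes `b = a n` exceed `n + 1` eventually; `a < ε` makes `l = a / ε < 1`.
  set a := (1 + ε) / 2 with ha
  have ha1 : 1 < a := by linarith
  have haε : a < ε := by linarith
  have hε0 : 0 < ε := by linarith
  have ha0 : 0 < a := by linarith
  have hα0 : 0 < α := by linarith
  have hl1 : a / ε < 1 := (div_lt_one hε0).2 haε
  have hl0 : 0 < a / ε := by positivity
  obtain ⟨K, hK, hexp⟩ := exists_exp_mul_min_le hα hl0 hl1
  obtain ⟨K', -, hK'⟩ := exists_abs_le_mul_exp_posLog_rpow hα
  set M := (∫⁻ x in Set.Ioi (0 : ℝ),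
      capacity PP {ω | x < Real.exp (Real.posLog |X ω| ^ α)}).toReal with hMdef
  have hM : 0 ≤ M := ENNReal.toReal_nonneg
  have hf : Measurable fun x : ℝ => Real.exp (Real.posLog |x| ^ α) := by
    unfold Real.posLog
    fun_prop
  have hfM : ∀ P ∈ PP, ∫⁻ ω, ENNReal.ofReal (Real.exp (Real.posLog |X ω| ^ α))
      ∂(P : Measure Ω) ≤ ENNReal.ofReal M := by
    intro P hP
    rw [hMdef, ENNReal.ofReal_toReal hint.ne]
    exact lintegral_le_lintegral_capacity PP hP (hf.comp (𝓔.measurable_of_mem X hX))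
      fun ω => (Real.exp_pos _).le
  -- The constant in `(log b) ^ (2 α) ≤ D b`, which bounds `n t²`.
  set D := (2 * α / 1) ^ (2 * α) with hD
  refine ⟨Real.exp (D * (K * M)), (Real.exp_pos _).le, ?_⟩
  filter_upwards [tendsto_natCast_atTop_atTop.eventually_ge_atTop (Real.exp α),
    tendsto_natCast_atTop_atTop.eventually_gt_atTop (1 / (a - 1))] with n hn1 hn2
  have hn0 : (0 : ℝ) < n := (Real.exp_pos α).trans_le hn1
  have hn1' : (1 : ℝ) ≤ n := (Real.one_le_exp hα0.le).trans hn1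
  set b := a * n with hb
  have hnb : (n : ℝ) ≤ b := le_mul_of_one_le_left hn0.le ha1.le
  have hb0 : 0 < b := hn0.trans_le hnb
  have hb1 : 1 ≤ b := hn1'.trans hnb
  have hnb' : (n : ℝ) + 1 < b := by
    rw [div_lt_iff₀ (by linarith)] at hn2
    linarith
  set t := a / ε * (Real.log b ^ α / b) with htdef
  have hlog : 0 ≤ Real.log b := Real.log_nonneg hb1
  have ht : 0 ≤ t := by positivity
  have hle := hexp b (hn1.trans hnb) t rfl
  have hmem := SubLinearExpectation.comp_mem_of_locLip hX
    (SubLinearExpectation.locLip_exp_min (b := b) ht)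
  obtain ⟨q, hq0, hq⟩ := SubLinearExpectation.exists_real_of_bounded hmem (a := 0)
    (b := Real.exp (t * b)) (fun ω => (Real.exp_pos _).le)
    fun ω => Real.exp_le_exp.2 (mul_le_mul_of_nonneg_left (min_le_right _ _) ht)
  have hqle : q ≤ 1 + t ^ 2 * (K * M) := by
    have := SubLinearExpectation.E_exp_mul_min_le hPP hX hmean hf (fun x => (Real.exp_pos _).le)
      hK' hM hfM ht hK hmem hle
    rwa [hq, EReal.coe_le_coe_iff] at this
  have hqk : ∀ k, 𝓔.E (fun ω => Real.exp (t * min (Xs k ω) b)) = q := fun k => by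
    rw [← hq]
    exact (hident k).eq_of_bounded (hXs k) hX (SubLinearExpectation.locLip_exp_min ht) (a := 0)
      (b := Real.exp (t * b)) (fun _ => (Real.exp_pos _).le)
      fun _ => Real.exp_le_exp.2 (mul_le_mul_of_nonneg_left (min_le_right _ _) ht)
  have hsum := hindep.E_exp_sum_min hXs ht hq0 hqk n
  have hnt : n * t ^ 2 ≤ D := by
    have h1 := log_rpow_le_mul_rpow (p := 2 * α) (by linarith) one_pos hb1
    rw [Real.rpow_one, two_mul, Real.rpow_add' hlog (by linarith), ← two_mul, ← hD] at h1
    have h2 : b * t ^ 2 = (a / ε) ^ 2 * ((Real.log b ^ α * Real.log b ^ α) / b) := by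
      rw [htdef]; field_simp
    have h3 : (Real.log b ^ α * Real.log b ^ α) / b ≤ D := by rwa [div_le_iff₀ hb0]
    have h4 : (a / ε) ^ 2 ≤ 1 := pow_le_one₀ hl0.le hl1.le
    have h5 : 0 ≤ (Real.log b ^ α * Real.log b ^ α) / b := by positivity
    nlinarith [mul_le_mul_of_nonneg_right hnb (sq_nonneg t)]
  have hqn : q ^ n ≤ Real.exp (D * (K * M)) := by
    have hKM : 0 ≤ K * M := mul_nonneg hK hM
    calc q ^ n ≤ Real.exp (t ^ 2 * (K * M)) ^ n :=
          pow_le_pow_left₀ hq0 (hqle.trans (by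
            rw [add_comm]; exact Real.add_one_le_exp _)) n
      _ = Real.exp (n * t ^ 2 * (K * M)) := by rw [← Real.exp_nat_mul, mul_assoc]
      _ ≤ _ := Real.exp_le_exp.2 (mul_le_mul_of_nonneg_right hnt hKM)
  have hchern := SubLinearExpectation.capacity_lt_le_exp_mul hPP ht
    (SubLinearExpectation.exp_sum_min_mem hXs (b := b) ht n) hsum.le (n * ε)
  have htn : Real.log n ^ α ≤ t * (n * ε) := by
    have h1 : t * (n * ε) = Real.log b ^ α := by
      rw [htdef, hb]; field_simp
    rw [h1]
    exact Real.rpow_le_rpow (Real.log_nonneg hn1') (Real.log_le_log hn0 hnb) hα0.le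
  have hsub : {ω | (n : ℝ) * ε < ∑ k ∈ Finset.range n, Xs k ω} ⊆
      (⋃ k ∈ Finset.range n, {ω | b < Xs k ω}) ∪
        {ω | (n : ℝ) * ε < ∑ k ∈ Finset.range n, min (Xs k ω) b} := by
    intro ω hω
    by_cases h : ∃ k ∈ Finset.range n, b < Xs k ω
    · obtain ⟨k, hk, hkb⟩ := h
      exact Or.inl (Set.mem_biUnion (Finset.mem_coe.2 hk) hkb)
    · push Not at h
      refine Or.inr ?_
      have : ∑ k ∈ Finset.range n, min (Xs k ω) b = ∑ k ∈ Finset.range n, Xs k ω :=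
        Finset.sum_congr rfl fun k hk => min_eq_left (h k hk)
      rw [Set.mem_ofPred, this]
      exact hω
  refine (capacity_mono PP hsub).trans ((capacity_union_le PP _ _).trans (add_le_add ?_ ?_))
  · refine (capacity_biUnion_finset_le PP _ _).trans ?_
    refine (Finset.sum_le_sum fun k _ => SubLinearExpectation.capacity_lt_le_of_sameDistrib hPP
      (hident k) (hXs k) hX hnb').trans_eq ?_
    simp
  · refine hchern.trans (ENNReal.ofReal_le_ofReal ?_)
    rw [mul_comm]
    exact mul_le_mul hqn (Real.exp_le_exp.2 (neg_le_neg htn)) (Real.exp_pos _).le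
      (Real.exp_pos _).le

/-! ### Convergence of the two majorizing series. -/

lemma monotone_exp_log_rpow {α : ℝ} (hα : 0 ≤ α) :
    Monotone fun n : ℕ => Real.exp (Real.log n ^ α) := by
  intro m n hmn
  refine Real.exp_le_exp.2 (Real.rpow_le_rpow (Real.log_natCast_nonneg m) ?_ hα)
  rcases Nat.eq_zero_or_pos m with rfl | hm
  · simpa using Real.log_natCast_nonneg n
  · exact Real.log_le_log (by exact_mod_cast hm) (by exact_mod_cast hmn)

/-- The increments are lengths of disjoint intervals. For `x` in the `n`-th one, `|X| > n + 1`
forces `exp ((log⁺ |X|)^α) > x`. The term `n = 0` vanishes since `Real.log 0 = 0`. -/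
lemma tsum_sub_mul_capacity_le (PP : Set (ProbabilityMeasure Ω)) (X : Ω → ℝ) {α : ℝ}
    (hα : 0 ≤ α) :
    ∑' n : ℕ, ENNReal.ofReal
        (Real.exp (Real.log ((n : ℝ) + 1) ^ α) - Real.exp (Real.log n ^ α)) *
      capacity PP {ω | (n : ℝ) + 1 < |X ω|} ≤
    ∫⁻ x in Set.Ioi (0 : ℝ), capacity PP {ω | x < Real.exp (Real.posLog |X ω| ^ α)} := by
  set F : ℕ → ℝ := fun n => Real.exp (Real.log n ^ α) with hF
  have hmono : Monotone F := monotone_exp_log_rpow hα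
  calc _ ≤ ∑' n : ℕ, ∫⁻ x in Set.Ioo (F n) (F (n + 1)),
        capacity PP {ω | x < Real.exp (Real.posLog |X ω| ^ α)} := by
        refine ENNReal.tsum_le_tsum fun n => ?_
        have h : ∀ x ∈ Set.Ioo (F n) (F (n + 1)), capacity PP {ω | (n : ℝ) + 1 < |X ω|} ≤
            capacity PP {ω | x < Real.exp (Real.posLog |X ω| ^ α)} := by
          intro x hx
          refine capacity_mono PP fun ω hω => ?_
          have hω : (n : ℝ) + 1 < |X ω| := hω
          refine hx.2.trans_le (Real.exp_le_exp.2 (Real.rpow_le_rpow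
            (Real.log_natCast_nonneg _) (le_trans ?_ (le_max_right _ _)) hα))
          push_cast
          exact Real.log_le_log (by positivity) hω.le
        refine le_trans (Eq.le ?_) (setLIntegral_mono' measurableSet_Ioo h)
        rw [setLIntegral_const, Real.volume_Ioo, mul_comm]
        simp [hF]
    _ = ∫⁻ x in ⋃ n : ℕ, Set.Ioo (F n) (F (n + 1)),
        capacity PP {ω | x < Real.exp (Real.posLog |X ω| ^ α)} :=
      (lintegral_iUnion (fun _ => measurableSet_Ioo) hmono.pairwise_disjoint_on_Ioo_succ _).symm
    _ ≤ _ := lintegral_mono_set (Set.iUnion_subset fun n x hx => (Real.exp_pos _).trans hx.1)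

lemma summable_log_rpow_div_sq {p : ℝ} (hp : 0 < p) :
    Summable fun n : ℕ => Real.log n ^ p / (n : ℝ) ^ 2 := by
  have hs : Summable fun n : ℕ => (p / (1 / 2)) ^ p * ((n : ℝ) ^ (3 / 2 : ℝ))⁻¹ :=
    (Real.summable_nat_rpow_inv.2 (by norm_num)).mul_left _
  refine hs.of_nonneg_of_le
    (fun n => div_nonneg (Real.rpow_nonneg (Real.log_natCast_nonneg n) _) (sq_nonneg _))
    fun n => ?_
  rcases Nat.eq_zero_or_pos n with rfl | hn
  · simp
  have hn1 : (1 : ℝ) ≤ n := by exact_mod_cast hn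
  have hn0 : (0 : ℝ) < n := by linarith
  have h := log_rpow_le_mul_rpow hp (q := 1 / 2) (by norm_num) hn1
  rw [div_le_iff₀ (by positivity)]
  refine h.trans_eq ?_
  rw [mul_assoc, ← Real.rpow_neg hn0.le, ← Real.rpow_natCast, ← Real.rpow_add hn0]
  norm_num

end SubLin

theorem theorem3p1 {Ω : Type*} [MeasurableSpace Ω] (𝓔 : SubLin.SubLinearExpectation Ω)
    (hreg : 𝓔.Regular) (hcsa : 𝓔.CountablySubadditive)
    (PP : Set (ProbabilityMeasure Ω)) (hPP : SubLin.Represents PP 𝓔)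
    (α : ℝ) (hα : 1 < α)
    (X : Ω → ℝ) (Xs : ℕ → Ω → ℝ) (hX : X ∈ 𝓔.H) (hXs : ∀ k, Xs k ∈ 𝓔.H)
    (hindep : 𝓔.IndepSeq Xs) (hident : ∀ k, 𝓔.SameDistrib (Xs k) X)
    (hmean : 𝓔.E X = 0) (hmean' : 𝓔.E (fun ω => -X ω) = 0)
    (hint : SubLin.choquet (SubLin.capacity PP)
      (fun ω => Real.exp ((Real.posLog |X ω|) ^ α)) < ⊤)
    (ε : ℝ) (hε : 1 < ε) :
    (∑' n : ℕ+, ENNReal.ofReal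
        (Real.exp ((Real.log (n : ℕ)) ^ α) * (Real.log (n : ℕ)) ^ (α - 1) / ((n : ℕ) : ℝ) ^ 2) *
      SubLin.capacity PP {ω | ((n : ℕ) : ℝ) * ε < |∑ k ∈ Finset.range n, Xs k ω|}) < ⊤ := by
  have hfin := SubLin.lintegral_capacity_lt_top PP (fun ω => (Real.exp_pos _).le) hint
  obtain ⟨C₁, hC₁, h₁⟩ := SubLin.exists_capacity_sum_gt_le 𝓔 hPP hα hX hXs hindep hident
    hmean.le hfin hε
  obtain ⟨C₂, hC₂, h₂⟩ := SubLin.exists_capacity_sum_gt_le 𝓔 hPP hα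
    (SubLin.SubLinearExpectation.neg_mem hX)
    (fun k => SubLin.SubLinearExpectation.neg_mem (hXs k)) hindep.neg
    (fun k => (hident k).neg) hmean'.le (by simpa only [abs_neg] using hfin) hε
  obtain ⟨N, hN⟩ := eventually_atTop.1 (h₁.and h₂)
  set w : ℕ → ℝ := fun n =>
    Real.exp (Real.log n ^ α) * Real.log n ^ (α - 1) / (n : ℝ) ^ 2 with hw
  have hw0 : ∀ n, 0 ≤ w n := fun n => div_nonneg (mul_nonneg (Real.exp_pos _).le
    (Real.rpow_nonneg (Real.log_natCast_nonneg n) _)) (sq_nonneg _)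
  set V : ℕ → ℝ≥0∞ := fun n => SubLin.capacity PP {ω | (n : ℝ) + 1 < |X ω|} with hV
  -- `A` covers the finitely many `n` before the deviation bounds apply, `G` the large summands and
  -- `T` the truncated sums. The 4 in `G` is 2 from `weight_mul_le_sub` times 2 tails.
  set A : ℕ → ℝ≥0∞ := fun n => if n < N then ENNReal.ofReal (w n) else 0
  set G : ℕ → ℝ≥0∞ := fun n => 4 * (ENNReal.ofReal
    (Real.exp (Real.log ((n : ℝ) + 1) ^ α) - Real.exp (Real.log n ^ α)) * V n)
  set T : ℕ → ℝ≥0∞ := fun n =>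
    ENNReal.ofReal ((C₁ + C₂) * (Real.log n ^ (α - 1) / (n : ℝ) ^ 2))
  have hbound : ∀ n : ℕ, 1 ≤ n → ENNReal.ofReal (w n) *
      SubLin.capacity PP {ω | (n : ℝ) * ε < |∑ k ∈ Finset.range n, Xs k ω|} ≤
        A n + (G n + T n) := by
    intro n hn
    rcases lt_or_ge n N with h | h
    · refine le_add_right ?_
      simp only [A, if_pos h]
      exact mul_le_of_le_one_right' (SubLin.capacity_le_one PP _)
    refine le_add_left ?_
    obtain ⟨hn₁, hn₂⟩ := hN n h
    have hn1 : (1 : ℝ) ≤ n := by exact_mod_cast hn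
    have hcap : SubLin.capacity PP {ω | (n : ℝ) * ε < |∑ k ∈ Finset.range n, Xs k ω|} ≤
        ENNReal.ofReal n * (2 * V n) +
          ENNReal.ofReal ((C₁ + C₂) * Real.exp (-(Real.log n ^ α))) := by
      have hsub : {ω | (n : ℝ) * ε < |∑ k ∈ Finset.range n, Xs k ω|} ⊆
          {ω | (n : ℝ) * ε < ∑ k ∈ Finset.range n, Xs k ω} ∪
            {ω | (n : ℝ) * ε < ∑ k ∈ Finset.range n, -Xs k ω} := by
        intro ω hω
        rw [Set.mem_ofPred, lt_abs] at hω
        simpa [Finset.sum_neg_distrib] using hω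
      refine (SubLin.capacity_mono PP hsub).trans ((SubLin.capacity_union_le PP _ _).trans
        ((add_le_add hn₁ hn₂).trans ?_))
      have e₁ : SubLin.capacity PP {ω | (n : ℝ) + 1 < X ω} ≤ V n :=
        SubLin.capacity_mono PP fun ω hω =>
          Set.mem_ofPred.2 (lt_of_lt_of_le (Set.mem_ofPred.1 hω) (le_abs_self (X ω)))
      have e₂ : SubLin.capacity PP {ω | (n : ℝ) + 1 < -X ω} ≤ V n :=
        SubLin.capacity_mono PP fun ω hω =>
          Set.mem_ofPred.2 (lt_of_lt_of_le (Set.mem_ofPred.1 hω) (neg_le_abs (X ω)))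
      rw [ENNReal.ofReal_natCast, add_mul, ENNReal.ofReal_add (by positivity) (by positivity),
        add_add_add_comm, two_mul, mul_add]
      gcongr
    refine (mul_le_mul_right hcap _).trans ?_
    rw [mul_add]
    refine add_le_add ?_ (Eq.le ?_)
    · rw [← mul_assoc, ← ENNReal.ofReal_mul (hw0 n)]
      refine (mul_le_mul_left (ENNReal.ofReal_le_ofReal
        (SubLin.weight_mul_le_sub hα hn1)) _).trans_eq ?_
      rw [ENNReal.ofReal_mul zero_le_two, ENNReal.ofReal_ofNat]
      simp only [G]
      ring
    · rw [← ENNReal.ofReal_mul (hw0 n)]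
      simp only [T, hw]
      rw [Real.exp_neg]
      congr 1
      field_simp
  have hA : ∑' n, A n < ⊤ := by
    rw [tsum_eq_sum (s := Finset.range N) fun n hn => if_neg (by simpa using hn)]
    refine ENNReal.sum_lt_top.2 fun n _ => ?_
    show (if n < N then ENNReal.ofReal (w n) else 0) < ⊤
    split_ifs <;> simp
  have hG : ∑' n, G n < ⊤ := by
    rw [ENNReal.tsum_mul_left]
    exact ENNReal.mul_lt_top (by simp)
      ((SubLin.tsum_sub_mul_capacity_le PP X (by linarith)).trans_lt hfin)
  have hT : ∑' n, T n < ⊤ :=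
    ((SubLin.summable_log_rpow_div_sq (sub_pos.2 hα)).mul_left (C₁ + C₂)).tsum_ofReal_lt_top
  calc _ ≤ ∑' n : ℕ+, (A n + (G n + T n)) :=
        ENNReal.tsum_le_tsum fun n => hbound n n.pos
    _ ≤ ∑' n : ℕ, (A n + (G n + T n)) :=
        ENNReal.tsum_comp_le_tsum_of_injective PNat.coe_injective fun n => A n + (G n + T n)
    _ = ∑' n, A n + (∑' n, G n + ∑' n, T n) := by rw [ENNReal.tsum_add, ENNReal.tsum_add]
    _ < ⊤ := ENNReal.add_lt_top.2 ⟨hA, ENNReal.add_lt_top.2 ⟨hG, hT⟩⟩
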